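/- For $n\ge 1$ and $k\ge 0$ put $\chi_n(k)=\prod_{j=1}^{k}\bigl(1-\frac{j-1}{n}\bigr)$, with $\chi_n(0)=1$. Let $f$ be a function of a real or complex variable (real-valued in the real case, complex-valued in the complex case), let $x_0,x$ be two points, and suppose that $f$ is analytic at every point of the closed segment $[x_0,x]$. Let $$\hat f_n(y)=\sum_{k=0}^{n}\chi_n(k)\,\frac{f^{(k)}(x_0)}{k!}\,(y-x_0)^k ,$$ and suppose that $\hat f_n\to f$ uniformly, as $n\to\infty$, on a segment $[x_0,\;x+\delta(x-x_0)]$ for some $\delta>0$, that is, on a segment from $x_0$ that extends (by however little) beyond $x$. Then, as $n\to\infty$, $$f(x)-\hat f_n(x)=\frac{f''(x)\,(x-x_0)^2}{2n}+o\!\left(\frac1n\right).$$ In particular $f(x)-\hat f_n(x)=O(1/n)$. If moreover $x\ne x_0$ and $f''(x)\neq 0$, then $$f(x)-\hat f_n(x)\;\sim\;\frac{f''(x)\,(x-x_0)^2}{2n},$$ so that the convergence $\hat f_n(x)\to f(x)$ is algebraic of exact order $1/n$. In the real case with $x\neq x_0$: if $f''(x)>0$, then $\hat f_n(x)<f(x)$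 for all sufficiently large $n$ (convergence from below), and if $f''(x)<0$, then $\hat f_n(x)>f(x)$ for all sufficiently large $n$ (convergence from above). -/

import Mathlib

open Filter Topology Asymptotics

/-- The weight `χ_n(k) = ∏_{j=1}^{k} (1 - (j - 1) / n)`; the empty product gives `χ_n(0) = 1`. -/
noncomputable def chiWeight (n k : ℕ) : ℝ :=
  ∏ j ∈ Finset.Icc 1 k, (1 - ((j : ℝ) - 1) / (n : ℝ))

/-- The `χ`-approximant
`f̂_n(y) = ∑_{k=0}^{n} χ_n(k) * f^{(k)}(x₀) / k! * (y - x₀)^k` of `f` about `x₀`. -/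
noncomputable def chiApprox {𝕜 : Type*} [RCLike 𝕜] (f : 𝕜 → 𝕜) (x₀ : 𝕜) (n : ℕ) (y : 𝕜) : 𝕜 :=
  ∑ k ∈ Finset.range (n + 1),
    (chiWeight n k : 𝕜) * (iteratedDeriv k f x₀ / (k.factorial : 𝕜)) * (y - x₀) ^ k

/-! Write `v` for the vector from `x₀` to the end of the longer segment, so that `x = x₀ + r v` with
`r = 1 / (1 + δ) < 1`, and let `c k` be the approximant of order `k` at the far end `x₀ + v`. Abel's
binomial theorem turns the approximant of order `n` at `x₀ + r v` into an average of `c 0, …, c n`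
with nonnegative weights that do not depend on `f` (`chiApprox_segment`). For fixed `k` these
weights tend to the Borel weights `B k r`, and their difference from the limit, multiplied by `n`,
tends to `-(r² / 2)` times the second `r`-derivative of `B k`
(`tendsto_mul_abelWeight_sub_borelWeight`, `borelWeight_mul_correction`). Everything is dominated by
a polynomial in `k` times `(r e^(1-r))^k`, a summable sequence because `r < 1`. Convergence at the
far end makes `c` bounded, so dominated convergence gives `f (x₀ + s v) = ∑ B k s • c k` for `0 < s
< 1`, and the scaled error tends to `r² / 2` times the termwise second derivative of this series. By
the chain rule that derivative is `v² f''(x)`, and `r v = x - x₀`. PART comes from this scheme: only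
pointwise convergence on the segment and analyticity at `x` enter. -/

/-! ### Abel's binomial theorem. -/

open Polynomial in
/-- **Abel's binomial theorem**, as an identity of polynomials. -/
theorem abel_binomial (z : ℝ) (n : ℕ) (x : ℝ) :
    (X + C x : ℝ[X]) ^ n = ∑ k ∈ Finset.range (n + 1),
      C ((n.choose k : ℝ) * (if k = 0 then 1 else x * (x + k * z) ^ (k - 1))) *
        (X - C (k * z)) ^ (n - k) := by
  induction n with
  | zero => simp
  | succ n ih =>
    set a : ℕ → ℝ := fun k => if k = 0 then 1 else x * (x + k * z) ^ (k - 1) with ha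
    rw [← sub_eq_zero]
    set p : ℝ[X] := (X + C x) ^ (n + 1) - ∑ k ∈ Finset.range (n + 1 + 1),
      C (((n + 1).choose k : ℝ) * a k) * (X - C (k * z)) ^ (n + 1 - k) with hp
    -- Differentiating the identity of degree `n + 1` gives `n + 1` times that of degree `n`, so the
    -- two sides differ by a constant.
    have hd : derivative p = 0 := by
      rw [hp, derivative_sub, derivative_sum, Finset.sum_range_succ]
      have : ∀ k ∈ Finset.range (n + 1),
          derivative (C (((n + 1).choose k : ℝ) * a k) * (X - C (k * z)) ^ (n + 1 - k)) =
            C (n + 1 : ℝ) * (C ((n.choose k : ℝ) * a k) * (X - C (k * z)) ^ (n - k)) := by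
        intro k hk
        have hk' : k ≤ n := by simpa [Nat.lt_succ_iff] using hk
        rw [derivative_C_mul, derivative_X_sub_C_pow, ← mul_assoc, ← mul_assoc,
          ← C_mul, ← C_mul, show n + 1 - k - 1 = n - k by omega]
        congr 2
        have h1 := Nat.choose_mul_succ_eq n k
        have h2 : ((n.choose k : ℝ)) * (n + 1) = (n + 1).choose k * ((n + 1 - k : ℕ) : ℝ) := by
          exact_mod_cast h1
        linear_combination -(a k) * h2
      rw [Finset.sum_congr rfl this, ← Finset.mul_sum, ← ih, derivative_X_add_C_pow]
      simp
    -- At `-x` the left side vanishes and the factors `x + k z` merge into `n`-th powers; what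
    -- remains is `x` times an `(n + 1)`-st finite difference of a polynomial of degree at most `n`.
    have he : p.eval (-x) = 0 := by
      have hdiff := congrFun (Polynomial.fwdDiff_iter_eq_zero_of_degree_lt (n := n + 1)
        (P := (C x + C z * X) ^ n) ((natDegree_pow_le_of_le n
          (natDegree_add_le_of_degree_le (n := 1) (by simp) ((natDegree_C_mul_le z X).trans natDegree_X_le))).trans_lt
          (by simp))) 0
      rw [fwdDiff_iter_eq_sum_shift] at hdiff
      have hs : ∑ k ∈ Finset.range (n + 1 + 1), (((n + 1).choose k : ℝ) * a k) *
          (-x - k * z) ^ (n + 1 - k) = x * ∑ k ∈ Finset.range (n + 1 + 1),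
            ((-1 : ℤ) ^ (n + 1 - k) * (n + 1).choose k) •
              Polynomial.eval (0 + k • (1 : ℝ)) ((C x + C z * X) ^ n) := by
        rw [Finset.mul_sum]
        refine Finset.sum_congr rfl fun k hk => ?_
        have hk' : k ≤ n + 1 := by simpa [Nat.lt_succ_iff] using hk
        have hneg : (-x - k * z) ^ (n + 1 - k) = (-1) ^ (n + 1 - k) * (x + k * z) ^ (n + 1 - k) := by
          rw [← mul_pow]; ring_nf
        simp only [zsmul_eq_mul, eval_pow, eval_add, eval_mul, eval_C, eval_X, nsmul_eq_mul]
        push_cast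
        rw [hneg]
        rcases Nat.eq_zero_or_pos k with rfl | hk0
        · simp [ha]; ring
        · have : (x + z * (0 + k * 1)) ^ n = (x + k * z) ^ (k - 1) * (x + k * z) ^ (n + 1 - k) := by
            rw [← pow_add, show k - 1 + (n + 1 - k) = n by omega]; ring_nf
          rw [this]
          simp [ha, hk0.ne']; ring
      have : p.eval (-x) = -∑ k ∈ Finset.range (n + 1 + 1), (((n + 1).choose k : ℝ) * a k) *
          (-x - k * z) ^ (n + 1 - k) := by
        simp [hp, eval_finsetSum]
      rw [this, hs, hdiff]
      simp
    have hc := eq_C_of_derivative_eq_zero hd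
    rw [hc, eval_C] at he
    rw [hc, he, C_0]

/-! ### Abel weights and the averaging identity. -/

/-- The weights with which the values at the far end of a segment give `chiApprox` at the point
with parameter `r`. -/
noncomputable def abelWeight (n k : ℕ) (r : ℝ) : ℝ :=
  (1 - r) * ((n.choose k : ℝ) * (k * r / n) ^ k * (1 - k * r / n) ^ (n - k) / (1 - k * r / n))

theorem one_sub_mul_div_pos {n k : ℕ} {r : ℝ} (hr0 : 0 ≤ r) (hr1 : r < 1) (hk : k ≤ n) :
    0 < 1 - k * r / n := by
  rcases Nat.eq_zero_or_pos n with rfl | hn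
  · simp
  · have hn' : (0 : ℝ) < n := by exact_mod_cast hn
    have hk' : (k : ℝ) ≤ n := by exact_mod_cast hk
    rw [sub_pos, div_lt_one hn']
    nlinarith

-- This is the averaging identity for a single monomial. It compares coefficients of `X ^ j` in
-- Abel's identity with step `r / n` and parameter `1 - r`, after the shift `X ↦ X + r` and the
-- reflection `k ↦ n - k`.
open Polynomial in
theorem choose_mul_div_pow_eq_sum_abelWeight {n : ℕ} (hn : n ≠ 0) {r : ℝ} (hr0 : 0 ≤ r)
    (hr1 : r < 1) (j : ℕ) :
    (n.choose j : ℝ) / n ^ j * r ^ j =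
      ∑ k ∈ Finset.range (n + 1), abelWeight n k r * ((k.choose j : ℝ) / k ^ j) := by
  have hn' : (n : ℝ) ≠ 0 := by exact_mod_cast hn
  set ρ : ℝ := r / n with hρ
  have hnρ : n * ρ = r := by rw [hρ]; field_simp
  have habel := congrArg (fun p : ℝ[X] => (p.comp (X + C r)).coeff j) (abel_binomial ρ n (1 - r))
  have hl : ((X + C (1 - r) : ℝ[X]) ^ n).comp (X + C r) = (X + C 1) ^ n := by
    simp [add_assoc]
  have hr : ∀ k ∈ Finset.range (n + 1),
      ((C ((n.choose k : ℝ) * (if k = 0 then 1 else (1 - r) * (1 - r + k * ρ) ^ (k - 1))) *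
        (X - C (k * ρ)) ^ (n - k) : ℝ[X]).comp (X + C r)).coeff j =
      (n.choose k : ℝ) * (if k = 0 then 1 else (1 - r) * (1 - r + k * ρ) ^ (k - 1)) *
        ((((n - k : ℕ) : ℝ) * ρ) ^ (n - k - j) * ((n - k).choose j : ℝ)) := by
    intro k hk
    have hk' : k ≤ n := by simpa [Nat.lt_succ_iff] using hk
    have : ((X - C (k * ρ) : ℝ[X]) ^ (n - k)).comp (X + C r) =
        (X + C (((n - k : ℕ) : ℝ) * ρ)) ^ (n - k) := by
      rw [pow_comp, sub_comp, X_comp, C_comp, add_sub_assoc, ← C_sub, Nat.cast_sub hk', sub_mul,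
        hnρ]
    rw [mul_comp, C_comp, coeff_C_mul, this, coeff_X_add_C_pow]
  simp only [hl, Polynomial.sum_comp, finsetSum_coeff] at habel
  rw [Finset.sum_congr rfl hr, coeff_X_add_C_pow, one_pow, one_mul,
    ← Finset.sum_range_reflect] at habel
  rw [div_mul_eq_mul_div, mul_div_assoc, ← div_pow, ← hρ, habel, Finset.sum_mul]
  refine Finset.sum_congr rfl fun k hk => ?_
  have hk' : k ≤ n := by simpa [Nat.lt_succ_iff] using hk
  have e1 : n + 1 - 1 - k = n - k := by omega
  have e2 : n - (n - k) = k := by omega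
  have e3 : k * r / n = k * ρ := by rw [hρ]; ring
  have hpos := one_sub_mul_div_pos hr0 hr1 hk'
  rw [e3] at hpos
  rw [e1, e2, Nat.choose_symm hk', abelWeight, e3]
  -- Dividing by `1 - k r / n` replaces the truncated exponent `n - k - 1` and also covers `k = n`,
  -- where the quotient cancels the factor `1 - r`.
  have hv : (if n - k = 0 then (1 : ℝ) else
      (1 - r) * (1 - r + ((n - k : ℕ) : ℝ) * ρ) ^ (n - k - 1)) =
      (1 - r) * ((1 - k * ρ) ^ (n - k) / (1 - k * ρ)) := by
    split_ifs with h0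
    · have : k = n := by omega
      subst this
      have : 1 - r ≠ 0 := by linarith
      simp [hnρ, this]
    · obtain ⟨m, hm⟩ := Nat.exists_eq_succ_of_ne_zero h0
      have hbase : 1 - r + ((n - k : ℕ) : ℝ) * ρ = 1 - k * ρ := by
        rw [Nat.cast_sub hk']; linear_combination hnρ
      rw [hbase, hm, Nat.succ_sub_one, pow_succ]
      field_simp
  have hq : ((k : ℝ) * ρ) ^ (k - j) * (k.choose j : ℝ) * ρ ^ j =
      (k * ρ) ^ k * ((k.choose j : ℝ) / k ^ j) := by
    rcases lt_or_ge k j with h | h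
    · simp [Nat.choose_eq_zero_of_lt h]
    · rcases Nat.eq_zero_or_pos k with rfl | hk0
      · obtain rfl : j = 0 := by omega
        simp
      · have hk0' : (k : ℝ) ≠ 0 := by exact_mod_cast hk0.ne'
        have : ((k : ℝ) * ρ) ^ k = (k * ρ) ^ (k - j) * (k ^ j * ρ ^ j) := by
          rw [← mul_pow, ← pow_add, Nat.sub_add_cancel h]
        rw [this]
        field_simp
  rw [hv]
  linear_combination (n.choose k : ℝ) * ((1 - r) * ((1 - k * ρ) ^ (n - k) / (1 - k * ρ))) * hq

theorem chiWeight_div_factorial {n j : ℕ} (hj : j ≤ n) :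
    chiWeight n j / j.factorial = (n.choose j : ℝ) / n ^ j := by
  have h : chiWeight n j * n ^ j = n.descFactorial j := by
    induction j with
    | zero => simp [chiWeight]
    | succ j ih =>
      have hn : (n : ℝ) ≠ 0 := by
        have : n ≠ 0 := by omega
        exact_mod_cast this
      have hc : chiWeight n (j + 1) = chiWeight n j * (1 - j / n) := by
        rw [chiWeight, Finset.prod_Icc_succ_top (by omega), ← chiWeight]
        push_cast; ring_nf
      rw [Nat.descFactorial_succ, Nat.cast_mul, ← ih (by omega), hc, Nat.cast_sub (by omega)]
      field_simp
      ring
  have hn : (n : ℝ) ^ j ≠ 0 := by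
    rcases Nat.eq_zero_or_pos n with rfl | h0
    · obtain rfl : j = 0 := by omega
      simp
    · positivity
  have hf : (j.factorial : ℝ) ≠ 0 := by positivity
  rw [div_eq_div_iff hf hn, h, Nat.descFactorial_eq_factorial_mul_choose]
  push_cast; ring

section
variable {𝕜 : Type*} [RCLike 𝕜]

theorem chiApprox_eq_sum (f : 𝕜 → 𝕜) (x₀ : 𝕜) (n : ℕ) (y : 𝕜) :
    chiApprox f x₀ n y = ∑ j ∈ Finset.range (n + 1),
      (((n.choose j : ℝ) / n ^ j : ℝ) : 𝕜) * (iteratedDeriv j f x₀ * (y - x₀) ^ j) := by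
  refine Finset.sum_congr rfl fun j hj => ?_
  have hj' : j ≤ n := by simpa [Nat.lt_succ_iff] using hj
  rw [← chiWeight_div_factorial hj']
  push_cast; ring

/-- The approximant at an inner point of a segment is an average of the approximants of lower
order at the far end of the segment. -/
theorem chiApprox_segment (f : 𝕜 → 𝕜) (x₀ v : 𝕜) {n : ℕ} (hn : n ≠ 0) {r : ℝ} (hr0 : 0 ≤ r)
    (hr1 : r < 1) :
    chiApprox f x₀ n (x₀ + (r : 𝕜) * v) = ∑ k ∈ Finset.range (n + 1),
      (abelWeight n k r : 𝕜) * chiApprox f x₀ k (x₀ + v) := by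
  have hk : ∀ k ∈ Finset.range (n + 1), (abelWeight n k r : 𝕜) * chiApprox f x₀ k (x₀ + v) =
      ∑ j ∈ Finset.range (n + 1), ((abelWeight n k r * ((k.choose j : ℝ) / k ^ j) : ℝ) : 𝕜) *
        (iteratedDeriv j f x₀ * v ^ j) := by
    intro k hk
    rw [chiApprox_eq_sum, add_sub_cancel_left, Finset.mul_sum]
    -- The sum of order `k` extends to all `j ≤ n`, since `k.choose j` vanishes for `j > k`; the two
    -- sums can then be exchanged.
    refine Eq.trans (Finset.sum_congr rfl fun j _ => ?_)
      (Finset.sum_subset (Finset.range_mono (Finset.mem_range.1 hk)) fun j _ hj => ?_)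
    · push_cast; ring
    · have : k < j := by simpa [Nat.lt_succ_iff] using hj
      simp [Nat.choose_eq_zero_of_lt this]
  rw [Finset.sum_congr rfl hk, Finset.sum_comm, chiApprox_eq_sum, add_sub_cancel_left]
  refine Finset.sum_congr rfl fun j _ => ?_
  rw [← Finset.sum_mul, ← map_sum (algebraMap ℝ 𝕜)]
  rw [← choose_mul_div_pow_eq_sum_abelWeight hn hr0 hr1 j]
  simp only [← RCLike.algebraMap_eq_ofReal]
  push_cast [map_mul, map_pow]; ring

end

/-! ### Borel weights and bounds uniform in `n`. -/

/-- The limits of the weights `abelWeight n k r` as `n → ∞`. -/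
noncomputable def borelWeight (k : ℕ) (r : ℝ) : ℝ :=
  (1 - r) * ((k : ℝ) ^ k / k.factorial * (r * Real.exp (-r)) ^ k)

theorem pow_self_div_factorial_mul_le {r : ℝ} (hr0 : 0 ≤ r) (k : ℕ) :
    (k : ℝ) ^ k / k.factorial * (r * Real.exp (-r)) ^ k ≤ (r * Real.exp (1 - r)) ^ k := by
  have h1 : (k : ℝ) ^ k / k.factorial ≤ Real.exp 1 ^ k := by
    rw [← Real.exp_nat_mul, mul_one]
    exact Real.pow_div_factorial_le_exp _ (Nat.cast_nonneg k) k
  have h2 : r * Real.exp (1 - r) = Real.exp 1 * (r * Real.exp (-r)) := by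
    rw [sub_eq_add_neg, Real.exp_add]; ring
  rw [h2, mul_pow (Real.exp 1)]
  gcongr

theorem borelWeight_mem_Icc {r : ℝ} (hr0 : 0 ≤ r) (hr1 : r < 1) (k : ℕ) :
    borelWeight k r ∈ Set.Icc 0 ((r * Real.exp (1 - r)) ^ k) := by
  have h0 : 0 ≤ (k : ℝ) ^ k / k.factorial * (r * Real.exp (-r)) ^ k := by positivity
  have h1 := pow_self_div_factorial_mul_le hr0 k
  have h2 : 0 ≤ 1 - r := by linarith
  exact ⟨mul_nonneg h2 h0, (mul_le_of_le_one_left h0 (by linarith)).trans h1⟩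

/-- Comparison with the binomial probability of `k` successes at success rate `k / n`, which is at
most `1`: passing from `k r / n` to `k / n` costs only the factor `(r e^(1-r))^k`. The bound does
not involve `n`, as domination requires. -/
theorem abelWeight_mem_Icc {n : ℕ} (hn : n ≠ 0) {r : ℝ} (hr0 : 0 ≤ r) (hr1 : r < 1) (k : ℕ) :
    abelWeight n k r ∈ Set.Icc 0 ((r * Real.exp (1 - r)) ^ k) := by
  rcases lt_or_ge n k with hk | hk
  · simp only [abelWeight, Nat.choose_eq_zero_of_lt hk]
    constructor
    · simp
    · simp only [Nat.cast_zero, zero_mul, zero_div, mul_zero]; positivity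
  have hn' : (0 : ℝ) < n := by positivity
  have hpos := one_sub_mul_div_pos hr0 hr1 hk
  have hkn : (k : ℝ) ≤ n := by exact_mod_cast hk
  have h2 : 0 ≤ 1 - r := by linarith
  have hbin : (n.choose k : ℝ) * (k / n : ℝ) ^ k * (1 - k / n : ℝ) ^ (n - k) ≤ 1 := by
    have hk1 : (k / n : ℝ) ≤ 1 := (div_le_one hn').2 hkn
    have h := add_pow (k / n : ℝ) (1 - k / n) n
    rw [add_sub_cancel, one_pow] at h
    refine le_trans (le_trans (le_of_eq (by ring)) (Finset.single_le_sum (f := fun m =>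
      (k / n : ℝ) ^ m * (1 - k / n) ^ (n - m) * (n.choose m : ℝ)) (fun i _ => ?_)
      (Finset.mem_range.2 (Nat.lt_succ_of_le hk)))) h.symm.le
    have : 0 ≤ (1 - k / n : ℝ) := by linarith
    positivity
  have hexp : (1 - k * r / n : ℝ) ^ (n - k) ≤
      (1 - k / n : ℝ) ^ (n - k) * Real.exp (1 - r) ^ k := by
    rcases hk.eq_or_lt with rfl | hlt
    · simp only [Nat.sub_self, pow_zero, one_mul]
      exact one_le_pow₀ (Real.one_le_exp h2)
    · have hlt' : (0 : ℝ) < n - k := by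
        have : (k : ℝ) < n := by exact_mod_cast hlt
        linarith
      have hu : 0 < (1 - k / n : ℝ) := by
        rw [sub_pos, div_lt_one hn']; linarith
      have hc := Real.add_one_le_exp (k * (1 - r) / (n - k))
      -- With this factorisation, `1 + t ≤ e^t` raised to the power `n - k` yields exactly
      -- `e^(k(1-r))`.
      have : (1 - k * r / n : ℝ) = (1 - k / n) * (k * (1 - r) / (n - k) + 1) := by
        field_simp; ring
      rw [this, mul_pow]
      gcongr
      refine (pow_le_pow_left₀ (by positivity) hc _).trans (le_of_eq ?_)
      rw [← Real.exp_nat_mul, ← Real.exp_nat_mul, Nat.cast_sub hk]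
      congr 1
      field_simp
  have hfrac : (1 - r) / (1 - k * r / n) ≤ 1 := by
    rw [div_le_one hpos]
    have : k * r / n ≤ r := by rw [div_le_iff₀ hn']; nlinarith
    linarith
  have hu : 0 ≤ (1 - k / n : ℝ) := by
    rw [sub_nonneg, div_le_one hn']; exact hkn
  have heq : abelWeight n k r = (1 - r) / (1 - k * r / n) *
      ((n.choose k : ℝ) * (k / n : ℝ) ^ k * r ^ k * (1 - k * r / n) ^ (n - k)) := by
    rw [abelWeight, show (k * r / n : ℝ) ^ k = (k / n : ℝ) ^ k * r ^ k by rw [← mul_pow]; ring_nf]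
    ring
  rw [heq]
  constructor
  · positivity
  · calc _ ≤ 1 * ((n.choose k : ℝ) * (k / n : ℝ) ^ k * r ^ k * (1 - k * r / n) ^ (n - k)) := by
          gcongr
      _ ≤ 1 * ((n.choose k : ℝ) * (k / n : ℝ) ^ k * r ^ k *
            ((1 - k / n : ℝ) ^ (n - k) * Real.exp (1 - r) ^ k)) := by gcongr
      _ = ((n.choose k : ℝ) * (k / n : ℝ) ^ k * (1 - k / n : ℝ) ^ (n - k)) *
            (r * Real.exp (1 - r)) ^ k := by rw [mul_pow]; ring
      _ ≤ 1 * (r * Real.exp (1 - r)) ^ k := by gcongr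
      _ = _ := one_mul _

theorem abelWeight_eq_borelWeight_mul {n k : ℕ} (hk : k < n) {r : ℝ} :
    abelWeight n k r = borelWeight k r *
      ((n.descFactorial k : ℝ) / n ^ k * ((1 - k * r / n) ^ (n - k) / (1 - k * r / n)) *
        Real.exp (k * r)) := by
  have hn : (n : ℝ) ≠ 0 := by
    have : n ≠ 0 := by omega
    exact_mod_cast this
  have hf : (k.factorial : ℝ) ≠ 0 := by positivity
  have he : Real.exp (-r) ^ k * Real.exp (k * r) = 1 := by
    rw [← Real.exp_nat_mul, ← Real.exp_add]; simp
  rw [abelWeight, borelWeight, Nat.descFactorial_eq_factorial_mul_choose, mul_pow, div_pow, mul_pow]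
  push_cast
  calc _ = (1 - r) * ((n.choose k : ℝ) * (k ^ k * r ^ k / n ^ k) *
        ((1 - k * r / n) ^ (n - k) / (1 - k * r / n))) *
          (Real.exp (-r) ^ k * Real.exp (k * r)) := by rw [he]; ring
    _ = _ := by field_simp

/-- The falling factorial quotient lies between `1 - k² / n` and `1`, by Bernoulli; the remaining
factor lies between `1 - k² / n` and `1 + 2 (k + 1)² / n`. The condition on `k` keeps the exponent
`x (k + 1)` in the range where `|e^t - 1| ≤ 2 |t|`. -/
theorem abs_correction_sub_one_le {n k : ℕ} (hn : n ≠ 0) (hk : k * (k + 1) ≤ n) {r : ℝ}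
    (hr0 : 0 ≤ r) (hr1 : r < 1) :
    |(n.descFactorial k : ℝ) / n ^ k * ((1 - k * r / n) ^ (n - k) / (1 - k * r / n)) *
        Real.exp (k * r) - 1| ≤ 2 * (k + 1) ^ 2 / n := by
  have hkn : k < n := by
    rcases Nat.eq_zero_or_pos k with rfl | h
    · omega
    · nlinarith
  have hn' : (0 : ℝ) < n := by positivity
  have hpos := one_sub_mul_div_pos hr0 hr1 hkn.le
  set x : ℝ := k * r / n with hx
  have hx0 : 0 ≤ x := by positivity
  have hnx : n * x = k * r := by rw [hx]; field_simp
  have hkR : (k : ℝ) * (k + 1) ≤ n := by exact_mod_cast hk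
  have hpow : (1 - x) ^ (n - k) / (1 - x) = (1 - x) ^ (n - k - 1) := by
    rw [div_eq_iff hpos.ne', ← pow_succ]; congr 1; omega
  have hk0 : (0 : ℝ) ≤ k := Nat.cast_nonneg k
  have hd1 : (n.descFactorial k : ℝ) / n ^ k ≤ 1 := by
    rw [div_le_one (by positivity)]
    exact_mod_cast Nat.descFactorial_le_pow n k
  have hd2 : 1 - (k : ℝ) ^ 2 / n ≤ (n.descFactorial k : ℝ) / n ^ k := by
    have h1 : ((n + 1 - k : ℕ) : ℝ) ^ k ≤ n.descFactorial k := by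
      exact_mod_cast Nat.pow_sub_le_descFactorial n k
    have h2 : 1 + (k : ℝ) * (-(k / n)) ≤ (1 + -(k / n)) ^ k := by
      refine one_add_mul_le_pow ?_ k
      have : (k / n : ℝ) ≤ 1 := (div_le_one hn').2 (by exact_mod_cast hkn.le)
      linarith
    have h3 : (1 + -(k / n) : ℝ) ^ k * n ^ k = ((n - k : ℝ)) ^ k := by
      rw [← mul_pow]; congr 1; field_simp; ring
    have h4 : (n - k : ℝ) ^ k ≤ ((n + 1 - k : ℕ) : ℝ) ^ k := by
      have : ((n + 1 - k : ℕ) : ℝ) = n + 1 - k := by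
        rw [Nat.cast_sub (by omega)]; push_cast; ring
      have h5 : (k : ℝ) < n := by exact_mod_cast hkn
      rw [this]
      exact pow_le_pow_left₀ (by linarith) (by linarith) k
    rw [le_div_iff₀ (by positivity)]
    calc (1 - (k : ℝ) ^ 2 / n) * n ^ k = (1 + (k : ℝ) * (-(k / n))) * n ^ k := by ring
      _ ≤ (1 + -(k / n)) ^ k * n ^ k := by gcongr
      _ ≤ _ := by rw [h3]; exact h4.trans h1
  have hk2 : (k : ℝ) ^ 2 / n ≤ 1 := by rw [div_le_one hn']; nlinarith
  have hmain1 : (1 - x) ^ (n - k - 1) * Real.exp (k * r) ≤ 1 + 2 * (k + 1) ^ 2 / n := by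
    have hle : (1 - x) ^ (n - k - 1) ≤ Real.exp (-(x * (n - k - 1))) := by
      have := pow_le_pow_left₀ hpos.le (Real.one_sub_le_exp_neg x) (n - k - 1)
      rw [← Real.exp_nat_mul] at this
      refine this.trans (le_of_eq ?_)
      rw [Nat.cast_sub (by omega), Nat.cast_sub hkn.le]; push_cast; ring_nf
    have hxk0 : 0 ≤ x * (k + 1) := by positivity
    have hxk : x * (k + 1) ≤ (k + 1) ^ 2 / n := by
      rw [hx, div_mul_eq_mul_div]
      gcongr
      nlinarith
    have hxk1 : x * (k + 1) ≤ 1 := by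
      rw [hx, div_mul_eq_mul_div, div_le_one hn']
      nlinarith
    have hexp := (abs_le.1 (Real.abs_exp_sub_one_le (x := x * (k + 1))
      (by rw [abs_of_nonneg hxk0]; exact hxk1))).2
    rw [abs_of_nonneg hxk0] at hexp
    calc _ ≤ Real.exp (-(x * (n - k - 1))) * Real.exp (k * r) := by gcongr
      _ = Real.exp (x * (k + 1)) := by
        rw [← Real.exp_add]; congr 1; linear_combination -hnx
      _ ≤ 1 + 2 * (k + 1) ^ 2 / n := by rw [mul_div_assoc]; linarith
  have hmain2 : 1 - (k : ℝ) ^ 2 / n ≤ (1 - x) ^ (n - k - 1) * Real.exp (k * r) := by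
    have h1 : (1 - x) ^ n ≤ (1 - x) ^ (n - k - 1) :=
      pow_le_pow_of_le_one hpos.le (by linarith) (by omega)
    have hxx : x ≤ 1 := by linarith
    -- Since `k r = n x`, this is the `n`-th power of `(1 - x)(1 + x) ≤ (1 - x) e^x`; Bernoulli then
    -- bounds the left side from below.
    have h2 : (1 - x ^ 2) ^ n ≤ (1 - x) ^ n * Real.exp (k * r) := by
      rw [← hnx, Real.exp_nat_mul, ← mul_pow]
      refine pow_le_pow_left₀ (by nlinarith) ?_ n
      nlinarith [Real.add_one_le_exp x]
    have h3 : 1 + (n : ℝ) * (-x ^ 2) ≤ (1 + -x ^ 2) ^ n := one_add_mul_le_pow (by nlinarith) n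
    have h4 : n * x ^ 2 ≤ (k : ℝ) ^ 2 / n := by
      have : n * x ^ 2 = k ^ 2 / n * r ^ 2 := by rw [hx]; field_simp
      rw [this]
      exact mul_le_of_le_one_right (by positivity) (by nlinarith)
    calc 1 - (k : ℝ) ^ 2 / n ≤ 1 + (n : ℝ) * (-x ^ 2) := by linarith
      _ ≤ (1 + -x ^ 2) ^ n := h3
      _ = (1 - x ^ 2) ^ n := by ring
      _ ≤ (1 - x) ^ n * Real.exp (k * r) := h2
      _ ≤ _ := by gcongr
  rw [hpow, mul_assoc]
  set D := (n.descFactorial k : ℝ) / n ^ k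
  set M := (1 - x) ^ (n - k - 1) * Real.exp (k * r)
  have hM0 : 0 ≤ M := by positivity
  have hb : (k : ℝ) ^ 2 / n ≤ (k + 1) ^ 2 / n := by gcongr; linarith
  rw [mul_div_assoc] at hmain1 ⊢
  rw [abs_le]
  constructor
  · nlinarith [mul_le_mul hd2 hmain2 (by linarith) (by linarith), sq_nonneg ((k : ℝ) ^ 2 / n)]
  · nlinarith

/-- This is the dominating sequence for the term of order `1 / n`. For `k (k + 1) ≤ n` the relative
error estimate applies; for larger `k` both weights are at most `(r e^(1-r))^k` and the factor `n`
is itself below `2 (k + 1)²`. -/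
theorem abs_mul_abelWeight_sub_borelWeight_le {n : ℕ} (hn : n ≠ 0) {r : ℝ} (hr0 : 0 ≤ r)
    (hr1 : r < 1) (k : ℕ) :
    |n * (abelWeight n k r - borelWeight k r)| ≤
      2 * (k + 1) ^ 2 * (r * Real.exp (1 - r)) ^ k := by
  have hn' : (0 : ℝ) < n := by positivity
  have hb := borelWeight_mem_Icc hr0 hr1 k
  have ha := abelWeight_mem_Icc hn hr0 hr1 k
  set Q := (r * Real.exp (1 - r)) ^ k
  rw [abs_mul, abs_of_pos hn']
  rcases le_or_gt (k * (k + 1)) n with hk | hk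
  · have hkn : k < n := by
      rcases Nat.eq_zero_or_pos k with rfl | h
      · omega
      · nlinarith
    have hc := abs_correction_sub_one_le hn hk hr0 hr1
    rw [abelWeight_eq_borelWeight_mul hkn, ← mul_sub_one, abs_mul, abs_of_nonneg hb.1]
    calc _ ≤ n * (Q * (2 * (k + 1) ^ 2 / n)) := by
          have := hb.2
          gcongr
      _ = _ := by field_simp
  · have h1 : |abelWeight n k r - borelWeight k r| ≤ Q := by
      rw [abs_le]; constructor <;> linarith [ha.1, ha.2, hb.1, hb.2]
    have hQ := hb.1.trans hb.2
    have h2 : (n : ℝ) ≤ 2 * (k + 1) ^ 2 := by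
      have : (n : ℝ) < k * (k + 1) := by exact_mod_cast hk
      nlinarith [Nat.cast_nonneg (α := ℝ) k]
    gcongr

/-! ### First-order expansions in `1 / n`. -/

theorem tendsto_of_mul_sub_one {u : ℕ → ℝ} {a : ℝ}
    (hu : Tendsto (fun n : ℕ => n * (u n - 1)) atTop (𝓝 a)) : Tendsto u atTop (𝓝 1) := by
  have h := (hu.mul tendsto_inv_atTop_nhds_zero_nat).const_add 1
  rw [mul_zero, add_zero] at h
  refine h.congr' ?_
  filter_upwards [eventually_ne_atTop 0] with n hn
  have : (n : ℝ) ≠ 0 := by exact_mod_cast hn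
  field_simp; ring

/-- Sequences `1 + a / n + o(1 / n)` are closed under products, and the coefficients `a` add; the
correction factor of the weights is expanded factor by factor in this way. -/
theorem tendsto_mul_mul_sub_one {u v : ℕ → ℝ} {a b : ℝ}
    (hu : Tendsto (fun n : ℕ => n * (u n - 1)) atTop (𝓝 a))
    (hv : Tendsto (fun n : ℕ => n * (v n - 1)) atTop (𝓝 b)) :
    Tendsto (fun n : ℕ => n * (u n * v n - 1)) atTop (𝓝 (a + b)) := by
  have h := (hu.mul (tendsto_of_mul_sub_one hv)).add hv
  rw [mul_one] at h
  exact h.congr fun n => by ring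

theorem tendsto_mul_pow_sub_one {u : ℕ → ℝ} {a : ℝ}
    (hu : Tendsto (fun n : ℕ => n * (u n - 1)) atTop (𝓝 a)) (m : ℕ) :
    Tendsto (fun n : ℕ => n * (u n ^ m - 1)) atTop (𝓝 (m * a)) := by
  induction m with
  | zero => simp
  | succ m ih =>
    have := tendsto_mul_mul_sub_one ih hu
    simp only [← pow_succ] at this
    rwa [show ((m + 1 : ℕ) : ℝ) * a = m * a + a by push_cast; ring]

theorem tendsto_mul_inv_sub_one {u : ℕ → ℝ} {a : ℝ}
    (hu : Tendsto (fun n : ℕ => n * (u n - 1)) atTop (𝓝 a)) :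
    Tendsto (fun n : ℕ => n * ((u n)⁻¹ - 1)) atTop (𝓝 (-a)) := by
  have h1 := tendsto_of_mul_sub_one hu
  have h := (hu.div h1 one_ne_zero).neg
  rw [div_one] at h
  refine h.congr' ?_
  filter_upwards [h1.eventually_ne one_ne_zero] with n hn
  simp only [Pi.div_apply]
  field_simp; ring

theorem tendsto_mul_exp_sub_one {L : ℕ → ℝ} {c : ℝ}
    (hL : Tendsto (fun n : ℕ => n * L n) atTop (𝓝 c)) :
    Tendsto (fun n : ℕ => n * (Real.exp (L n) - 1)) atTop (𝓝 c) := by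
  have hL0 : Tendsto L atTop (𝓝 0) := by
    have := (hL.mul tendsto_inv_atTop_nhds_zero_nat)
    rw [mul_zero] at this
    refine this.congr' ?_
    filter_upwards [eventually_ne_atTop 0] with n hn
    have : (n : ℝ) ≠ 0 := by exact_mod_cast hn
    field_simp
  have hz : Tendsto (fun n : ℕ => n * (Real.exp (L n) - 1 - L n)) atTop (𝓝 0) := by
    have hb : Tendsto (fun n : ℕ => |n * L n| * |L n|) atTop (𝓝 0) := by
      simpa using hL.abs.mul hL0.abs
    refine squeeze_zero_norm' ?_ hb
    have h1 : ∀ᶠ n in atTop, |L n| < 1 := hL0.abs.eventually_lt_const (by simp)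
    filter_upwards [h1] with n hn
    rw [Real.norm_eq_abs, abs_mul, abs_mul, mul_assoc, ← sq, sq_abs]
    gcongr
    exact Real.abs_exp_sub_one_sub_id_le hn.le
  have := hz.add hL
  rw [zero_add] at this
  exact this.congr fun n => by ring

/-- The logarithm of the product is `n log (1 - a / n) + a`, whose leading term is `-a² / (2 n)`. -/
theorem tendsto_mul_one_sub_div_pow_mul_exp_sub_one (a : ℝ) :
    Tendsto (fun n : ℕ => n * ((1 - a / n) ^ n * Real.exp a - 1)) atTop (𝓝 (-(a ^ 2) / 2)) := by
  have hx : Tendsto (fun n : ℕ => a / (n : ℝ)) atTop (𝓝 0) := tendsto_const_div_atTop_nhds_zero_nat a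
  have hL : Tendsto (fun n : ℕ => n * (n * Real.log (1 - a / n) + a)) atTop
      (𝓝 (-(a ^ 2) / 2)) := by
    have hz : Tendsto (fun n : ℕ => (n : ℝ) ^ 2 *
        (a / n + (a / n) ^ 2 / 2 + Real.log (1 - a / n))) atTop (𝓝 0) := by
      have hb : Tendsto (fun n : ℕ => a ^ 2 * (|a / n| / (1 - |a / n|))) atTop (𝓝 0) := by
        have := (hx.abs.div (hx.abs.const_sub 1) (by simp)).const_mul (a ^ 2)
        simpa using this
      refine squeeze_zero_norm' ?_ hb
      have h1 : ∀ᶠ n : ℕ in atTop, |a / n| < 1 := hx.abs.eventually_lt_const (by simp)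
      filter_upwards [h1, eventually_ne_atTop 0] with n hn hn0
      have hn0' : (n : ℝ) ≠ 0 := by exact_mod_cast hn0
      have h := Real.abs_log_sub_add_sum_range_le hn 2
      have hs : ∑ i ∈ Finset.range 2, (a / n) ^ (i + 1) / ((i : ℝ) + 1) =
          a / n + (a / n) ^ 2 / 2 := by
        rw [Finset.sum_range_succ, Finset.sum_range_one]; norm_num
      rw [hs] at h
      rw [Real.norm_eq_abs, abs_mul, abs_of_nonneg (sq_nonneg (n : ℝ))]
      calc _ ≤ (n : ℝ) ^ 2 * (|a / n| ^ (2 + 1) / (1 - |a / n|)) := by gcongr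
        _ = (n : ℝ) ^ 2 * |a / n| ^ 2 * (|a / n| / (1 - |a / n|)) := by ring
        _ = _ := by rw [sq_abs, div_pow]; field_simp
    have := hz.add_const (-(a ^ 2) / 2)
    rw [zero_add] at this
    refine this.congr' ?_
    filter_upwards [eventually_ne_atTop 0] with n hn0
    have hn0' : (n : ℝ) ≠ 0 := by exact_mod_cast hn0
    field_simp; ring
  refine (tendsto_mul_exp_sub_one hL).congr' ?_
  have h1 : ∀ᶠ n : ℕ in atTop, a / n < 1 := hx.eventually_lt_const (by simp)
  filter_upwards [h1] with n hn
  rw [Real.exp_add, Real.exp_nat_mul, Real.exp_log (by linarith)]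

theorem tendsto_mul_descFactorial_div_pow_sub_one (k : ℕ) :
    Tendsto (fun n : ℕ => n * ((n.descFactorial k : ℝ) / n ^ k - 1)) atTop
      (𝓝 (-(k * (k - 1) / 2))) := by
  induction k with
  | zero => simp
  | succ k ih =>
    have h1 : Tendsto (fun n : ℕ => n * ((1 - k / n : ℝ) - 1)) atTop (𝓝 (-k)) := by
      refine tendsto_const_nhds.congr' ?_
      filter_upwards [eventually_ne_atTop 0] with n hn0
      have hn0' : (n : ℝ) ≠ 0 := by exact_mod_cast hn0
      field_simp; ring
    have h := tendsto_mul_mul_sub_one ih h1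
    rw [show -((k : ℝ) * (k - 1) / 2) + -k = -(((k + 1 : ℕ) : ℝ) * (((k + 1 : ℕ) : ℝ) - 1) / 2) by
      push_cast; ring] at h
    refine h.congr' ?_
    filter_upwards [eventually_gt_atTop k] with n hn
    have hn0' : (n : ℝ) ≠ 0 := by
      have : n ≠ 0 := by omega
      exact_mod_cast this
    rw [Nat.descFactorial_succ, Nat.cast_mul, Nat.cast_sub hn.le]
    congr 2
    field_simp
    ring

theorem tendsto_mul_abelWeight_sub_borelWeight (k : ℕ) (r : ℝ) :
    Tendsto (fun n : ℕ => n * (abelWeight n k r - borelWeight k r)) atTop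
      (𝓝 (borelWeight k r * ((-(k * (k - 1)) + 2 * k * (k + 1) * r - k ^ 2 * r ^ 2) / 2))) := by
  have hx : Tendsto (fun n : ℕ => k * r / (n : ℝ)) atTop (𝓝 0) :=
    tendsto_const_div_atTop_nhds_zero_nat _
  have h1 : Tendsto (fun n : ℕ => n * ((1 - k * r / n : ℝ) - 1)) atTop (𝓝 (-(k * r))) := by
    refine tendsto_const_nhds.congr' ?_
    filter_upwards [eventually_ne_atTop 0] with n hn0
    have hn0' : (n : ℝ) ≠ 0 := by exact_mod_cast hn0
    field_simp; ring
  have h2 := tendsto_mul_mul_sub_one (tendsto_mul_descFactorial_div_pow_sub_one k)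
    (tendsto_mul_mul_sub_one (tendsto_mul_pow_sub_one (tendsto_mul_inv_sub_one h1) (k + 1))
      (tendsto_mul_one_sub_div_pow_mul_exp_sub_one (k * r)))
  have h3 := h2.const_mul (borelWeight k r)
  rw [show -((k : ℝ) * (k - 1) / 2) + (((k + 1 : ℕ) : ℝ) * - -(k * r) + -((k * r) ^ 2) / 2) =
    (-(k * (k - 1)) + 2 * k * (k + 1) * r - k ^ 2 * r ^ 2) / 2 by push_cast; ring] at h3
  refine h3.congr' ?_
  have hlt : ∀ᶠ n : ℕ in atTop, k * r / n < 1 := hx.eventually_lt_const (by simp)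
  filter_upwards [eventually_gt_atTop k, hlt] with n hn hn1
  have hpos : (1 - k * r / n : ℝ) ≠ 0 := by linarith
  have hpow : (1 - k * r / n : ℝ) ^ (n - k) / (1 - k * r / n) =
      ((1 - k * r / n : ℝ)⁻¹) ^ (k + 1) * (1 - k * r / n) ^ n := by
    have : (1 - k * r / n : ℝ) ^ n = (1 - k * r / n) ^ (n - k) * (1 - k * r / n) ^ k := by
      rw [← pow_add, Nat.sub_add_cancel hn.le]
    rw [this, inv_pow, pow_succ]
    field_simp
  rw [abelWeight_eq_borelWeight_mul hn, hpow]
  ring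

/-! ### Derivatives of the Borel weights. -/

/-- The first derivative of `borelWeight k`. -/
noncomputable def borelWeightDeriv (k : ℕ) (r : ℝ) : ℝ :=
  (k : ℝ) ^ k / k.factorial * (r * Real.exp (-r)) ^ k * (k * ((1 - r) ^ 2 / r) - 1)

/-- The second derivative of `borelWeight k`. -/
noncomputable def borelWeightDerivTwo (k : ℕ) (r : ℝ) : ℝ :=
  (k : ℝ) ^ k / k.factorial * (r * Real.exp (-r)) ^ k *
    ((1 - r) * (k ^ 2 * (1 - r) ^ 2 - k - 2 * k * r) / r ^ 2)

theorem hasDerivAt_mul_exp_neg_pow (k : ℕ) {r : ℝ} (hr : r ≠ 0) :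
    HasDerivAt (fun r : ℝ => (k : ℝ) ^ k / k.factorial * (r * Real.exp (-r)) ^ k)
      ((k : ℝ) ^ k / k.factorial * (r * Real.exp (-r)) ^ k * (k * (1 - r) / r)) r := by
  have h1 : HasDerivAt (fun r : ℝ => r * Real.exp (-r)) (Real.exp (-r) * (1 - r)) r := by
    convert! (hasDerivAt_id r).mul (hasDerivAt_neg r).exp using 1
    simp; ring
  convert! (h1.pow k).const_mul ((k : ℝ) ^ k / k.factorial) using 1
  rcases k with _ | k
  · simp
  · rw [Nat.succ_sub_one, pow_succ (r * Real.exp (-r))]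
    field_simp

theorem hasDerivAt_borelWeight (k : ℕ) {r : ℝ} (hr : r ≠ 0) :
    HasDerivAt (borelWeight k) (borelWeightDeriv k r) r := by
  convert! ((hasDerivAt_id r).const_sub 1).mul (hasDerivAt_mul_exp_neg_pow k hr) using 1
  rw [borelWeightDeriv]
  simp only [id]
  field_simp; ring

theorem hasDerivAt_borelWeightDeriv (k : ℕ) {r : ℝ} (hr : r ≠ 0) :
    HasDerivAt (borelWeightDeriv k) (borelWeightDerivTwo k r) r := by
  have h := ((((hasDerivAt_id r).const_sub 1).pow 2).div (hasDerivAt_id r) hr).const_mul (k : ℝ)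
  convert! (hasDerivAt_mul_exp_neg_pow k hr).mul (h.sub_const 1) using 1
  rw [borelWeightDerivTwo]
  simp
  field_simp; ring

/-- This identity is where `f''` enters: the `1 / n` correction of each weight is a second
derivative in `r`. It mirrors the effect on monomials, where `r ^ j` acquires the correction `-(j (j
- 1) / 2) r ^ j`. -/
theorem borelWeight_mul_correction (k : ℕ) {r : ℝ} (hr : r ≠ 0) :
    borelWeight k r * ((-(k * (k - 1)) + 2 * k * (k + 1) * r - k ^ 2 * r ^ 2) / 2) =
      -(r ^ 2 / 2 * borelWeightDerivTwo k r) := by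
  rw [borelWeight, borelWeightDerivTwo]
  field_simp; ring

theorem mul_exp_one_sub_lt_one {r : ℝ} (hr : r < 1) : r * Real.exp (1 - r) < 1 := by
  have h := Real.add_one_lt_exp (x := r - 1) (by linarith)
  have h2 : Real.exp (r - 1) * Real.exp (1 - r) = 1 := by rw [← Real.exp_add]; simp
  nlinarith [Real.exp_pos (1 - r)]

theorem mul_exp_one_sub_le {r s : ℝ} (hr : 0 < r) (hrs : r ≤ s) (hs : s ≤ 1) :
    r * Real.exp (1 - r) ≤ s * Real.exp (1 - s) := by
  have h := Real.add_one_le_exp (r - s)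
  have h2 : Real.exp (1 - s) = Real.exp (r - s) * Real.exp (1 - r) := by
    rw [← Real.exp_add]; ring_nf
  have h3 : r ≤ s * Real.exp (r - s) := by nlinarith
  rw [h2, ← mul_assoc]
  gcongr

theorem abs_borelWeightDeriv_le (k : ℕ) {r : ℝ} (hr0 : 0 < r) (hr1 : r < 1) :
    |borelWeightDeriv k r| ≤ 4 * (k + 1) ^ 2 / r ^ 2 * (r * Real.exp (1 - r)) ^ k := by
  have hp := pow_self_div_factorial_mul_le hr0.le k
  have hk : (0 : ℝ) ≤ k := Nat.cast_nonneg k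
  have hb : |k * ((1 - r) ^ 2 / r) - 1| ≤ 4 * (k + 1) ^ 2 / r ^ 2 := by
    have h1 : (k : ℝ) * ((1 - r) ^ 2 / r) ≤ k / r ^ 2 := by
      rw [← mul_div_assoc, div_le_div_iff₀ hr0 (by positivity)]
      have : (1 - r) ^ 2 * r ≤ 1 := by nlinarith
      nlinarith [mul_nonneg hk hr0.le]
    have h2 : (1 : ℝ) ≤ 1 / r ^ 2 := by
      rw [le_div_iff₀ (by positivity)]; nlinarith
    have h3 : 0 ≤ (k : ℝ) * ((1 - r) ^ 2 / r) := by positivity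
    have h4 : (k : ℝ) / r ^ 2 + 1 / r ^ 2 ≤ 4 * (k + 1) ^ 2 / r ^ 2 := by
      rw [← add_div]; gcongr; nlinarith
    have h5 : 0 ≤ (k : ℝ) / r ^ 2 := by positivity
    rw [abs_le]; constructor <;> linarith
  rw [borelWeightDeriv, abs_mul, abs_of_nonneg (by positivity), mul_comm]
  gcongr

theorem abs_borelWeightDerivTwo_le (k : ℕ) {r : ℝ} (hr0 : 0 < r) (hr1 : r < 1) :
    |borelWeightDerivTwo k r| ≤ 4 * (k + 1) ^ 2 / r ^ 2 * (r * Real.exp (1 - r)) ^ k := by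
  have hp := pow_self_div_factorial_mul_le hr0.le k
  have hk : (0 : ℝ) ≤ k := Nat.cast_nonneg k
  have hb : |(1 - r) * (k ^ 2 * (1 - r) ^ 2 - k - 2 * k * r) / r ^ 2| ≤
      4 * (k + 1) ^ 2 / r ^ 2 := by
    rw [abs_div, abs_of_pos (show 0 < r ^ 2 by positivity), abs_mul,
      abs_of_nonneg (show 0 ≤ 1 - r by linarith)]
    refine div_le_div_of_nonneg_right ?_ (sq_nonneg r)
    have h1 : (k : ℝ) ^ 2 * (1 - r) ^ 2 ≤ k ^ 2 :=
      mul_le_of_le_one_right (by positivity) (by nlinarith)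
    have h2 : 0 ≤ (k : ℝ) ^ 2 * (1 - r) ^ 2 := by positivity
    have h3 : 0 ≤ (k : ℝ) * r := by positivity
    have h4 : (k : ℝ) * r ≤ k := mul_le_of_le_one_right hk hr1.le
    have h5 : |(k : ℝ) ^ 2 * (1 - r) ^ 2 - k - 2 * k * r| ≤ 4 * ((k : ℝ) + 1) ^ 2 := by
      rw [abs_le]; constructor <;> nlinarith
    have h6 : 1 - r ≤ 1 := by linarith
    exact (mul_le_of_le_one_left (abs_nonneg _) h6).trans h5
  rw [borelWeightDerivTwo, abs_mul, abs_of_nonneg (by positivity), mul_comm]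
  gcongr

theorem summable_add_one_sq_mul_pow {q : ℝ} (hq0 : 0 ≤ q) (hq1 : q < 1) :
    Summable fun k : ℕ => ((k : ℝ) + 1) ^ 2 * q ^ k := by
  have hq : ‖q‖ < 1 := by rwa [Real.norm_of_nonneg hq0]
  have h := fun m => summable_pow_mul_geometric_of_norm_lt_one m hq
  refine (((h 2).add ((h 1).mul_left 2)).add (h 0)).congr fun k => ?_
  ring

/-! ### Series in the Borel weights and the limit of the scaled error. -/

section
variable {𝕜 : Type*} [RCLike 𝕜]

theorem hasDerivAt_tsum_borelWeight {c : ℕ → 𝕜} {M : ℝ} (hM : ∀ k, ‖c k‖ ≤ M) {r : ℝ}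
    (hr0 : 0 < r) (hr1 : r < 1) :
    HasDerivAt (fun r => ∑' k, borelWeight k r • c k) (∑' k, borelWeightDeriv k r • c k) r ∧
    HasDerivAt (fun r => ∑' k, borelWeightDeriv k r • c k)
      (∑' k, borelWeightDerivTwo k r • c k) r := by
  have hM0 : 0 ≤ M := (norm_nonneg _).trans (hM 0)
  -- On `(r / 2, s)` the factor `1 / y²` stays bounded and `y e^(1-y)` is at most `s e^(1-s) < 1`,
  -- so one summable bound serves both termwise differentiations.
  set s : ℝ := (1 + r) / 2 with hs
  have hs1 : s < 1 := by rw [hs]; linarith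
  have hs0 : 0 < s := by rw [hs]; linarith
  set q : ℝ := s * Real.exp (1 - s) with hq
  have hq0 : 0 ≤ q := by positivity
  have hq1 : q < 1 := mul_exp_one_sub_lt_one hs1
  have hrt : r ∈ Set.Ioo (r / 2) s := ⟨by linarith, by rw [hs]; linarith⟩
  have hsum : Summable fun k : ℕ => 4 / (r / 2) ^ 2 * M * (((k : ℝ) + 1) ^ 2 * q ^ k) :=
    (summable_add_one_sq_mul_pow hq0 hq1).mul_left _
  have hbound : ∀ (w : ℕ → ℝ → ℝ), (∀ k : ℕ, ∀ {y : ℝ}, 0 < y → y < 1 →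
      |w k y| ≤ 4 * (k + 1) ^ 2 / y ^ 2 * (y * Real.exp (1 - y)) ^ k) →
      ∀ (k : ℕ), ∀ y ∈ Set.Ioo (r / 2) s,
        ‖w k y • c k‖ ≤ 4 / (r / 2) ^ 2 * M * (((k : ℝ) + 1) ^ 2 * q ^ k) := by
    intro w hw k y hy
    have hy0 : 0 < y := lt_trans (by linarith) hy.1
    have h1 := mul_exp_one_sub_le hy0 hy.2.le hs1.le
    rw [norm_smul, Real.norm_eq_abs]
    calc _ ≤ (4 * (k + 1) ^ 2 / y ^ 2 * (y * Real.exp (1 - y)) ^ k) * M :=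
          mul_le_mul (hw k hy0 (hy.2.trans hs1)) (hM k) (norm_nonneg _) (by positivity)
      _ ≤ (4 * (k + 1) ^ 2 / (r / 2) ^ 2 * q ^ k) * M := by
          have := hy.1.le
          gcongr
      _ = _ := by ring
  have hne : ∀ y ∈ Set.Ioo (r / 2) s, y ≠ 0 := fun y hy => (lt_trans (by linarith) hy.1).ne'
  have hs0 : Summable fun k => borelWeight k r • c k := by
    refine Summable.of_norm_bounded (g := fun k : ℕ => M * (r * Real.exp (1 - r)) ^ k)
      ((summable_geometric_of_lt_one (by positivity) (mul_exp_one_sub_lt_one hr1)).mul_left _)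
      fun k => ?_
    have hb := borelWeight_mem_Icc hr0.le hr1 k
    rw [norm_smul, Real.norm_of_nonneg hb.1, mul_comm]
    exact mul_le_mul (hM k) hb.2 hb.1 hM0
  have hb1 := hbound borelWeightDeriv abs_borelWeightDeriv_le
  exact ⟨hasDerivAt_tsum_of_isPreconnected hsum isOpen_Ioo isPreconnected_Ioo
      (fun k y hy => (hasDerivAt_borelWeight k (hne y hy)).smul_const (c k)) hb1 hrt hs0 hrt,
    hasDerivAt_tsum_of_isPreconnected hsum isOpen_Ioo isPreconnected_Ioo
      (fun k y hy => (hasDerivAt_borelWeightDeriv k (hne y hy)).smul_const (c k))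
      (hbound borelWeightDerivTwo abs_borelWeightDerivTwo_le) hrt
      (Summable.of_norm_bounded hsum fun k => hb1 k r hrt) hrt⟩

theorem hasSum_abelWeight_smul_chiApprox (f : 𝕜 → 𝕜) (x₀ v : 𝕜) {n : ℕ} (hn : n ≠ 0) {r : ℝ} (hr0 : 0 ≤ r)
    (hr1 : r < 1) :
    HasSum (fun k => abelWeight n k r • chiApprox f x₀ k (x₀ + v))
      (chiApprox f x₀ n (x₀ + (r : 𝕜) * v)) := by
  rw [chiApprox_segment f x₀ v hn hr0 hr1]
  simp only [← RCLike.real_smul_eq_coe_mul]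
  refine hasSum_sum_of_ne_finset_zero fun k hk => ?_
  have : n < k := by simpa [Nat.lt_succ_iff] using hk
  simp [abelWeight, Nat.choose_eq_zero_of_lt this]

theorem tendsto_abelWeight (k : ℕ) (r : ℝ) :
    Tendsto (fun n => abelWeight n k r) atTop (𝓝 (borelWeight k r)) := by
  have h := ((tendsto_mul_abelWeight_sub_borelWeight k r).mul
    tendsto_inv_atTop_nhds_zero_nat).add_const (borelWeight k r)
  rw [mul_zero, zero_add] at h
  refine h.congr' ?_
  filter_upwards [eventually_ne_atTop 0] with n hn
  have : (n : ℝ) ≠ 0 := by exact_mod_cast hn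
  field_simp; ring

/-- Bounded approximants at the end of a segment force convergence inside, with an expansion up
to the order `1 / n`. -/
theorem tendsto_chiApprox_of_bounded (f : 𝕜 → 𝕜) (x₀ v : 𝕜) {M : ℝ}
    (hM : ∀ k, ‖chiApprox f x₀ k (x₀ + v)‖ ≤ M) {r : ℝ} (hr0 : 0 < r) (hr1 : r < 1) :
    Tendsto (fun n => chiApprox f x₀ n (x₀ + (r : 𝕜) * v)) atTop
      (𝓝 (∑' k, borelWeight k r • chiApprox f x₀ k (x₀ + v))) ∧
    Tendsto (fun n : ℕ => (n : ℝ) • (chiApprox f x₀ n (x₀ + (r : 𝕜) * v) -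
        ∑' k, borelWeight k r • chiApprox f x₀ k (x₀ + v))) atTop
      (𝓝 (-((r ^ 2 / 2) • ∑' k, borelWeightDerivTwo k r • chiApprox f x₀ k (x₀ + v)))) := by
  set c : ℕ → 𝕜 := fun k => chiApprox f x₀ k (x₀ + v) with hc
  have hM0 : 0 ≤ M := (norm_nonneg _).trans (hM 0)
  set q : ℝ := r * Real.exp (1 - r) with hq
  have hq0 : 0 ≤ q := by positivity
  have hq1 : q < 1 := mul_exp_one_sub_lt_one hr1
  have hg : Summable fun k : ℕ => q ^ k * M := (summable_geometric_of_lt_one hq0 hq1).mul_right M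
  have hP : ∀ n : ℕ, n ≠ 0 → HasSum (fun k => abelWeight n k r • c k)
      (chiApprox f x₀ n (x₀ + (r : 𝕜) * v)) := fun n hn =>
    hasSum_abelWeight_smul_chiApprox f x₀ v hn hr0.le hr1
  have hW : Summable fun k => borelWeight k r • c k := by
    refine Summable.of_norm_bounded hg fun k => ?_
    have hb := borelWeight_mem_Icc hr0.le hr1 k
    rw [norm_smul, Real.norm_of_nonneg hb.1]
    exact mul_le_mul hb.2 (hM k) (norm_nonneg _) (by positivity)
  constructor
  -- The Abel weights vanish for `k > n`, so the finite averages are series over all `k` and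
  -- dominated convergence applies.
  · have := tendsto_tsum_of_dominated_convergence (𝓕 := atTop) (f := fun n k => abelWeight n k r • c k)
      (g := fun k => borelWeight k r • c k) hg
      (fun k => (tendsto_abelWeight k r).smul_const (c k)) (by
        filter_upwards [eventually_ne_atTop 0] with n hn k
        have hb := abelWeight_mem_Icc hn hr0.le hr1 k
        rw [norm_smul, Real.norm_of_nonneg hb.1]
        exact mul_le_mul hb.2 (hM k) (norm_nonneg _) (by positivity))
    refine this.congr' ?_
    filter_upwards [eventually_ne_atTop 0] with n hn using (hP n hn).tsum_eq
  · have hg2 : Summable fun k : ℕ => 2 * M * (((k : ℝ) + 1) ^ 2 * q ^ k) :=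
      (summable_add_one_sq_mul_pow hq0 hq1).mul_left _
    have := tendsto_tsum_of_dominated_convergence (𝓕 := atTop)
      (f := fun (n : ℕ) k => (n * (abelWeight n k r - borelWeight k r)) • c k)
      (g := fun k => (-(r ^ 2 / 2 * borelWeightDerivTwo k r)) • c k) hg2
      (fun k => by
        rw [← borelWeight_mul_correction k hr0.ne']
        exact (tendsto_mul_abelWeight_sub_borelWeight k r).smul_const (c k)) (by
        filter_upwards [eventually_ne_atTop 0] with n hn k
        rw [norm_smul, Real.norm_eq_abs]
        refine (mul_le_mul (abs_mul_abelWeight_sub_borelWeight_le hn hr0.le hr1 k) (hM k)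
          (norm_nonneg _) (by positivity)).trans (le_of_eq (by ring)))
    have heq : ∑' k, (-(r ^ 2 / 2 * borelWeightDerivTwo k r)) • c k =
        -((r ^ 2 / 2) • ∑' k, borelWeightDerivTwo k r • c k) := by
      simp only [neg_smul, mul_smul, tsum_neg, tsum_const_smul'']
    rw [heq] at this
    refine this.congr' ?_
    filter_upwards [eventually_ne_atTop 0] with n hn
    rw [← (hP n hn).tsum_eq, ← (hP n hn).summable.tsum_sub hW, ← tsum_const_smul'']
    simp only [mul_smul, sub_smul]

theorem HasDerivAt.comp_segment {g : 𝕜 → 𝕜} {g' x₀ v : 𝕜} {r : ℝ}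
    (h : HasDerivAt g g' (x₀ + (r : 𝕜) * v)) :
    HasDerivAt (fun r : ℝ => g (x₀ + (r : 𝕜) * v)) (v * g') r := by
  have hl : HasDerivAt (fun r : ℝ => x₀ + (r : 𝕜) * v) v r := by
    have := ((hasDerivAt_id r).smul_const v).const_add x₀
    simpa [RCLike.real_smul_eq_coe_mul] using this
  exact HasDerivAt.scomp r h hl

/-- By uniqueness of limits `f` agrees with the Borel series along the open segment, and by
uniqueness of derivatives the twice differentiated series is `v² f''`. -/
theorem tendsto_mul_sub_chiApprox {f : 𝕜 → 𝕜} {x₀ v : 𝕜} {r : ℝ} (hr0 : 0 < r) (hr1 : r < 1)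
    (hf : AnalyticAt 𝕜 f (x₀ + (r : 𝕜) * v))
    (hconv : ∀ s : ℝ, 0 ≤ s → s ≤ 1 → Tendsto (fun n => chiApprox f x₀ n (x₀ + (s : 𝕜) * v)) atTop
      (𝓝 (f (x₀ + (s : 𝕜) * v)))) :
    Tendsto (fun n : ℕ => (n : 𝕜) * (f (x₀ + (r : 𝕜) * v) -
        chiApprox f x₀ n (x₀ + (r : 𝕜) * v))) atTop
      (𝓝 (iteratedDeriv 2 f (x₀ + (r : 𝕜) * v) * ((r : 𝕜) * v) ^ 2 / 2)) := by
  obtain ⟨M, hM⟩ : ∃ M, ∀ k, ‖chiApprox f x₀ k (x₀ + v)‖ ≤ M := by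
    have := hconv 1 zero_le_one le_rfl
    simp only [RCLike.ofReal_one, one_mul] at this
    obtain ⟨M, hM⟩ := (Metric.isBounded_range_of_tendsto _ this).exists_norm_le
    exact ⟨M, fun k => hM _ (Set.mem_range_self k)⟩
  set c : ℕ → 𝕜 := fun k => chiApprox f x₀ k (x₀ + v) with hc
  have hF : ∀ s : ℝ, 0 < s → s < 1 → f (x₀ + (s : 𝕜) * v) = ∑' k, borelWeight k s • c k :=
    fun s h0 h1 => tendsto_nhds_unique (hconv s h0.le h1.le)
      (tendsto_chiApprox_of_bounded f x₀ v hM h0 h1).1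
  have hcont : Tendsto (fun s : ℝ => x₀ + (s : 𝕜) * v) (𝓝 r) (𝓝 (x₀ + (r : 𝕜) * v)) := by
    have : Continuous fun s : ℝ => x₀ + (s : 𝕜) * v := by fun_prop
    exact this.tendsto r
  -- Equality on a whole neighbourhood of `r` is needed here, since it is differentiated once more.
  have hF1 : (fun s : ℝ => v * deriv f (x₀ + (s : 𝕜) * v)) =ᶠ[𝓝 r]
      fun s => ∑' k, borelWeightDeriv k s • c k := by
    filter_upwards [hcont.eventually hf.eventually_analyticAt, Ioo_mem_nhds hr0 hr1] with s hs hs'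
    have h1 := hs.differentiableAt.hasDerivAt.comp_segment
    refine h1.unique ((hasDerivAt_tsum_borelWeight hM hs'.1 hs'.2).1.congr_of_eventuallyEq ?_)
    filter_upwards [Ioo_mem_nhds hs'.1 hs'.2] with t ht using hF t ht.1 ht.2
  have hF2 : v * (v * iteratedDeriv 2 f (x₀ + (r : 𝕜) * v)) =
      ∑' k, borelWeightDerivTwo k r • c k := by
    have h1 := (hf.deriv.differentiableAt.hasDerivAt.comp_segment).const_mul v
    have h2 := h1.unique
      ((hasDerivAt_tsum_borelWeight hM hr0 hr1).2.congr_of_eventuallyEq hF1)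
    rw [← h2, iteratedDeriv_succ, iteratedDeriv_one]
  have h := (tendsto_chiApprox_of_bounded f x₀ v hM hr0 hr1).2.neg
  rw [← hF2, neg_neg, ← hF r hr0 hr1] at h
  convert! h using 2
  · rw [RCLike.real_smul_eq_coe_mul]; push_cast; ring
  · rw [RCLike.real_smul_eq_coe_mul]; push_cast; ring

end

/-! ### From the limit of the scaled error to the asymptotic statements. -/

section
variable {𝕜 : Type*} [RCLike 𝕜]

theorem isTheta_one_div_natCast :
    (fun n : ℕ => 1 / (n : 𝕜)) =Θ[atTop] (fun n : ℕ => 1 / (n : ℝ)) :=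
  IsTheta.of_norm_eventuallyEq_norm (Eventually.of_forall fun n => by simp)

theorem asymptotics_of_tendsto_mul {u : ℕ → 𝕜} {A : 𝕜}
    (h : Tendsto (fun n : ℕ => (n : 𝕜) * u n) atTop (𝓝 (A / 2))) :
    (fun n : ℕ => u n - A / (2 * (n : 𝕜))) =o[atTop] (fun n : ℕ => 1 / (n : ℝ)) ∧
    u =O[atTop] (fun n : ℕ => 1 / (n : ℝ)) ∧
    (A ≠ 0 → u ~[atTop] (fun n : ℕ => A / (2 * (n : 𝕜))) ∧
      u =Θ[atTop] (fun n : ℕ => 1 / (n : ℝ))) := by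
  have h1 : (fun n : ℕ => u n - A / (2 * (n : 𝕜))) =o[atTop] (fun n : ℕ => 1 / (n : 𝕜)) := by
    have ho : (fun n : ℕ => (n : 𝕜) * u n - A / 2) =o[atTop] (fun _ : ℕ => (1 : 𝕜)) := by
      rw [isLittleO_one_iff]
      simpa using h.sub_const (A / 2)
    refine ((ho.mul_isBigO (isBigO_refl (fun n : ℕ => 1 / (n : 𝕜)) atTop)).congr' ?_ ?_)
    · filter_upwards [eventually_ne_atTop 0] with n hn
      have : (n : 𝕜) ≠ 0 := by exact_mod_cast hn
      field_simp
    · exact Eventually.of_forall fun n => one_mul _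
  have h2 : (fun n : ℕ => A / (2 * (n : 𝕜))) =O[atTop] (fun n : ℕ => 1 / (n : 𝕜)) :=
    ((isBigO_refl (fun n : ℕ => 1 / (n : 𝕜)) atTop).const_mul_left (A / 2)).congr_left
      fun n => by rw [div_mul_div_comm, mul_one]
  refine ⟨h1.trans_isTheta isTheta_one_div_natCast, ?_, fun hA => ?_⟩
  · exact ((h1.isBigO.add h2).congr_left fun n => sub_add_cancel _ _).trans_isTheta
      isTheta_one_div_natCast
  · have h3 : (fun n : ℕ => 1 / (n : 𝕜)) =Θ[atTop] (fun n : ℕ => A / (2 * (n : 𝕜))) := by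
      refine ⟨?_, h2⟩
      refine ((isBigO_refl (fun n : ℕ => A / (2 * (n : 𝕜))) atTop).const_mul_left
        (2 / A)).congr_left fun n => ?_
      rw [div_mul_div_comm, mul_left_comm A, ← mul_assoc, ← div_div, div_self (mul_ne_zero two_ne_zero hA)]
    have he : u ~[atTop] (fun n : ℕ => A / (2 * (n : 𝕜))) := h1.trans_isTheta h3
    exact ⟨he, he.isTheta.trans (h3.symm.trans isTheta_one_div_natCast)⟩

theorem tendsto_mul_sub_chiApprox_of_segment {f : 𝕜 → 𝕜} {x₀ x : 𝕜} {δ : ℝ} (hδ : 0 < δ)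
    (hf : AnalyticAt 𝕜 f x)
    (hconv : ∀ s : ℝ, 0 ≤ s → s ≤ 1 → Tendsto
      (fun n => chiApprox f x₀ n (x₀ + (s : 𝕜) * (x + (δ : 𝕜) * (x - x₀) - x₀))) atTop
      (𝓝 (f (x₀ + (s : 𝕜) * (x + (δ : 𝕜) * (x - x₀) - x₀))))) :
    Tendsto (fun n : ℕ => (n : 𝕜) * (f x - chiApprox f x₀ n x)) atTop
      (𝓝 (iteratedDeriv 2 f x * (x - x₀) ^ 2 / 2)) := by
  have hδ' : (1 : 𝕜) + δ ≠ 0 := by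
    have : (1 : ℝ) + δ ≠ 0 := by positivity
    exact_mod_cast this
  -- The far end lies at `x₀ + (1 + δ)(x - x₀)`, so `x` has parameter `(1 + δ)⁻¹`; positivity of `δ`
  -- is what makes this less than `1`.
  have hv : (((1 + δ)⁻¹ : ℝ) : 𝕜) * (x + (δ : 𝕜) * (x - x₀) - x₀) = x - x₀ := by
    push_cast
    field_simp; ring
  have h := tendsto_mul_sub_chiApprox (f := f) (x₀ := x₀) (v := x + (δ : 𝕜) * (x - x₀) - x₀)
    (r := (1 + δ)⁻¹) (by positivity) (inv_lt_one_of_one_lt₀ (by linarith))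
    (by rwa [hv, add_sub_cancel]) hconv
  rwa [hv, add_sub_cancel] at h

end

theorem eventually_pos_of_tendsto_natCast_mul {u : ℕ → ℝ} {a : ℝ} (ha : 0 < a)
    (h : Tendsto (fun n : ℕ => (n : ℝ) * u n) atTop (𝓝 a)) : ∀ᶠ n in atTop, 0 < u n := by
  filter_upwards [h.eventually_const_lt ha] with n hn
  exact pos_of_mul_pos_right hn (Nat.cast_nonneg n)

theorem mainTheorem4 :
    -- complex segments and complex functions
    (∀ (f : ℂ → ℂ) (x₀ x : ℂ) (δ : ℝ), 0 < δ →
      AnalyticOnNhd ℂ f (segment ℝ x₀ x) →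
      TendstoUniformlyOn (chiApprox f x₀) f atTop
        (segment ℝ x₀ (x + (δ : ℂ) * (x - x₀))) →
      (fun n : ℕ => f x - chiApprox f x₀ n x
          - iteratedDeriv 2 f x * (x - x₀) ^ 2 / (2 * (n : ℂ)))
        =o[atTop] (fun n : ℕ => 1 / (n : ℝ)) ∧
      (fun n : ℕ => f x - chiApprox f x₀ n x) =O[atTop] (fun n : ℕ => 1 / (n : ℝ)) ∧
      (x ≠ x₀ → iteratedDeriv 2 f x ≠ 0 →
        (fun n : ℕ => f x - chiApprox f x₀ n x) ~[atTop]
            (fun n : ℕ => iteratedDeriv 2 f x * (x - x₀) ^ 2 / (2 * (n : ℂ))) ∧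
          (fun n : ℕ => f x - chiApprox f x₀ n x) =Θ[atTop] (fun n : ℕ => 1 / (n : ℝ)))) ∧
    -- real segments and real functions, with the side from which the approximants converge
    (∀ (f : ℝ → ℝ) (x₀ x : ℝ) (δ : ℝ), 0 < δ →
      AnalyticOnNhd ℝ f (segment ℝ x₀ x) →
      TendstoUniformlyOn (chiApprox f x₀) f atTop
        (segment ℝ x₀ (x + δ * (x - x₀))) →
      (fun n : ℕ => f x - chiApprox f x₀ n x
          - iteratedDeriv 2 f x * (x - x₀) ^ 2 / (2 * (n : ℝ)))
        =o[atTop] (fun n : ℕ => 1 / (n : ℝ)) ∧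
      (fun n : ℕ => f x - chiApprox f x₀ n x) =O[atTop] (fun n : ℕ => 1 / (n : ℝ)) ∧
      (x ≠ x₀ → iteratedDeriv 2 f x ≠ 0 →
        (fun n : ℕ => f x - chiApprox f x₀ n x) ~[atTop]
            (fun n : ℕ => iteratedDeriv 2 f x * (x - x₀) ^ 2 / (2 * (n : ℝ))) ∧
          (fun n : ℕ => f x - chiApprox f x₀ n x) =Θ[atTop] (fun n : ℕ => 1 / (n : ℝ))) ∧
      (x ≠ x₀ → 0 < iteratedDeriv 2 f x → ∀ᶠ n : ℕ in atTop, chiApprox f x₀ n x < f x) ∧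
      (x ≠ x₀ → iteratedDeriv 2 f x < 0 → ∀ᶠ n : ℕ in atTop, f x < chiApprox f x₀ n x)) := by
  constructor
  · intro f x₀ x δ hδ hf hconv
    have h := tendsto_mul_sub_chiApprox_of_segment hδ (hf x (right_mem_segment ℝ x₀ x))
      fun s h0 h1 => hconv.tendsto_at (by
        rw [segment_eq_image']
        exact ⟨s, ⟨h0, h1⟩, by simp⟩)
    obtain ⟨ho, hO, hΘ⟩ := asymptotics_of_tendsto_mul h
    exact ⟨ho, hO, fun hx hd => hΘ (mul_ne_zero hd (pow_ne_zero 2 (sub_ne_zero.2 hx)))⟩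
  · intro f x₀ x δ hδ hf hconv
    have h := tendsto_mul_sub_chiApprox_of_segment hδ (hf x (right_mem_segment ℝ x₀ x))
      fun s h0 h1 => hconv.tendsto_at (by
        rw [segment_eq_image']
        exact ⟨s, ⟨h0, h1⟩, by simp⟩)
    obtain ⟨ho, hO, hΘ⟩ := asymptotics_of_tendsto_mul h
    refine ⟨ho, hO, fun hx hd => hΘ (mul_ne_zero hd (pow_ne_zero 2 (sub_ne_zero.2 hx))),
      fun hx hd => ?_, fun hx hd => ?_⟩
    · have hx2 : 0 < (x - x₀) ^ 2 := by have := sub_ne_zero.2 hx; positivity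
      filter_upwards [eventually_pos_of_tendsto_natCast_mul (by positivity) h] with n hn
      linarith
    · have hx2 : 0 < (x - x₀) ^ 2 := by have := sub_ne_zero.2 hx; positivity
      have hneg : 0 < -(iteratedDeriv 2 f x * (x - x₀) ^ 2 / 2) := by
        have := mul_neg_of_neg_of_pos hd hx2
        linarith
      have h' := h.neg
      simp only [← mul_neg] at h'
      filter_upwards [eventually_pos_of_tendsto_natCast_mul hneg h'] with n hn
      linarith
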